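/- Let $d\ge 0$, let $\mu$ be a probability distribution on $\mathbb{R}^{d\times d}$ with compact support $\mathcal M=\operatorname{supp}\mu$, and let $\|\cdot\|$ be any norm on $\mathbb{R}^d$. A proper cone in $\mathbb{R}^d$ is a closed convex set $K$, stable under multiplication by nonnegative scalars, with nonempty interior and with $K\cap(-K)=\{0\}$. Assume that (a) there is a proper cone $K\subset\mathbb{R}^d$ with $MK\subset K$ for every $M\in\mathcal M$; and (b) the singular part $\mu_s$ of $\mu$ with respect to Lebesgue measure on $\mathbb{R}^{d\times d}$ is of the form $\mu_s=\sum_{i=1}^N p_i\delta_{M_i}$ with $N\ge 0$, $p_i>0$ and $M_i\in\mathbb{R}^{d\times d}$. Let $A_0,A_1,\dots$ be independent random matrices, each with distribution $\mu$, and let $x(k;x_0)$ be the solution of $x(k+1)=A_kx(k)$, $x(0)=x_0$. The deterministic switched system $\Sigma_{\mathcal M}$ is called absolutely asymptotically stable if, for every sequence $(B_k)_{k\ge 0}$ in $\mathcal M$ and every initial state, the solution of $x(k+1)=B_kx(k)$ tends to $0$ as $k\to\infty$. Then the following three conditions are equivalent. 1. $\Sigma_{\mathcal M}$ is absolutely asymptotically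 stable. 2. There is a single $\gamma\in[0,1)$ such that for every integer $p\ge1$ the stochastic system is exponentially stable in $p$th mean with decay rate at most $\gamma$: there are $M,\beta>0$ (which may depend on $p$) with $e^{-\beta/p}\le\gamma$ and $E[\|x(k;x_0)\|^p]\le M e^{-\beta k}\|x_0\|^p$ for all $x_0\in\mathbb{R}^d$ and $k\ge0$. 3. There is a single $\gamma\in[0,1)$ such that for every integer $p\ge1$ and every $x_0\in\mathbb{R}^d$, $E[\|x(k;x_0)\|^p]^{1/p}=O(\gamma^k)$ as $k\to\infty$ (the implied constant may depend on $p$ and $x_0$). -/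

import Mathlib

open MeasureTheory ProbabilityTheory Filter Asymptotics
open scoped Topology ENNReal

namespace SwitchedSystem

/-- The space `ℝ^{d×d}` of real square matrices. -/
abbrev Mat (d : ℕ) : Type := Matrix (Fin d) (Fin d) ℝ

/-- The (Borel) product σ-algebra on `ℝ^{d×d}`. -/
instance instMeasurableSpaceMat (d : ℕ) : MeasurableSpace (Matrix (Fin d) (Fin d) ℝ) :=
  inferInstanceAs (MeasurableSpace (Fin d → Fin d → ℝ))

instance instBorelSpaceMat (d : ℕ) : BorelSpace (Matrix (Fin d) (Fin d) ℝ) :=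
  inferInstanceAs (BorelSpace (Fin d → Fin d → ℝ))

instance instSecondCountableTopologyMat (d : ℕ) :
    SecondCountableTopology (Matrix (Fin d) (Fin d) ℝ) :=
  inferInstanceAs (SecondCountableTopology (Fin d → Fin d → ℝ))

/-- Lebesgue measure on `ℝ^{d×d}`. -/
noncomputable def lebesgue (d : ℕ) : Measure (Mat d) :=
  Measure.map (Matrix.of : (Fin d → Fin d → ℝ) → Mat d) volume

instance instSigmaFiniteLebesgue (d : ℕ) : SigmaFinite (lebesgue d) := by
  have h : lebesgue d = (volume : Measure (Fin d → Fin d → ℝ)) := Measure.map_id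
  have i : SigmaFinite (volume : Measure (Fin d → Fin d → ℝ)) := inferInstance
  exact h ▸ i

/-- A proper cone in `ℝ^d`: a subset closed under multiplication by nonnegative scalars which is
closed, convex, solid (nonempty interior) and pointed (contains no line). -/
structure IsProperCone {d : ℕ} (K : Set (Fin d → ℝ)) : Prop where
  smul_mem : ∀ c : ℝ, 0 ≤ c → ∀ x ∈ K, c • x ∈ K
  isClosed : IsClosed K
  convex : Convex ℝ K
  solid : (interior K).Nonempty
  pointed : ∀ x, x ∈ K → -x ∈ K → x = 0

/-- The set of matrices `ℳ` leaves the set `K` invariant: `M K ⊆ K` for every `M ∈ ℳ`. -/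
def LeavesInvariant {d : ℕ} (ℳ : Set (Mat d)) (K : Set (Fin d → ℝ)) : Prop :=
  ∀ M ∈ ℳ, ∀ x ∈ K, M.mulVec x ∈ K

/-- The standing assumption on `μ`: the support of `μ` leaves a proper cone invariant, and the
singular part of `μ` (with respect to Lebesgue measure) is a finite (possibly empty) combination
`∑ pᵢ δ_{Mᵢ}` of point measures with `pᵢ > 0`. -/
structure ConeAndAtomicSingularPart {d : ℕ} (μ : Measure (Mat d)) : Prop where
  invariant_cone : ∃ K : Set (Fin d → ℝ), IsProperCone K ∧ LeavesInvariant μ.support K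
  singular_atomic : ∃ (N : ℕ) (p : Fin N → ℝ) (M : Fin N → Mat d), (∀ i, 0 < p i) ∧
    μ.singularPart (lebesgue d) = ∑ i, ENNReal.ofReal (p i) • Measure.dirac (M i)

/-- The solution of `x(k+1) = A_k x(k)`, `x(0) = x₀`. -/
def trajectory {d : ℕ} (A : ℕ → Mat d) (x₀ : Fin d → ℝ) : ℕ → (Fin d → ℝ)
  | 0 => x₀
  | k + 1 => (A k).mulVec (trajectory A x₀ k)

/-- The deterministic switched system `x(k+1) = A_k x(k)`, `A_k ∈ ℳ`, is absolutely asymptotically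
stable: `x(k) → 0` for every switching sequence in `ℳ` and every initial state. -/
def AbsolutelyAsymptoticallyStable {d : ℕ} (ℳ : Set (Mat d)) : Prop :=
  ∀ A : ℕ → Mat d, (∀ k, A k ∈ ℳ) → ∀ x₀ : Fin d → ℝ,
    Tendsto (trajectory A x₀) atTop (𝓝 0)

/-- `A_0, A_1, …` are independent random matrices, each with law `μ`. -/
structure FollowIndependently {d : ℕ} {Ω : Type*} [MeasurableSpace Ω]
    (A : ℕ → Ω → Mat d) (μ : Measure (Mat d)) (P : Measure Ω) : Prop where
  hasLaw : ∀ k, HasLaw (A k) μ P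
  indep : iIndepFun A P

/-- `E[‖x(k; x₀)‖^p]` for the stochastic system `x(k+1) = A_k x(k)` and the norm `nrm`. -/
noncomputable def meanPow {d : ℕ} {Ω : Type*} [MeasurableSpace Ω] (P : Measure Ω)
    (nrm : Seminorm ℝ (Fin d → ℝ)) (A : ℕ → Ω → Mat d) (p : ℕ) (x₀ : Fin d → ℝ) (k : ℕ) : ℝ :=
  ∫ ω, nrm (trajectory (fun j => A j ω) x₀ k) ^ p ∂P

/-- Exponential stability in `p`th mean, `E[‖x(k; x₀)‖^p] ≤ M e^{-βk} ‖x₀‖^p` with `M, β > 0`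
uniform in `x₀` and `k`, with decay rate at most `γ`, i.e. `(e^{-β})^{1/p} ≤ γ`. -/
def MeanStableWithRate {d : ℕ} {Ω : Type*} [MeasurableSpace Ω] (P : Measure Ω)
    (nrm : Seminorm ℝ (Fin d → ℝ)) (A : ℕ → Ω → Mat d) (p : ℕ) (γ : ℝ) : Prop :=
  ∃ M β : ℝ, 0 < M ∧ 0 < β ∧ Real.exp (-β) ^ (1 / (p : ℝ)) ≤ γ ∧
    ∀ (x₀ : Fin d → ℝ) (k : ℕ),
      meanPow P nrm A p x₀ k ≤ M * Real.exp (-β * k) * nrm x₀ ^ p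

end SwitchedSystem

/-!
Order `ℝ^d` by the cone `K`, and order matrices by `M ≤ A` when `A - M` maps `K` into itself; all
matrices in the support of `μ` are then nonnegative, and products are monotone. If each of finitely
many nonnegative matrices `M` satisfies `μ {A | M ≤ A} ≥ δ > 0`, then the random product of length
`k` dominates a given word in them with probability at least `δ ^ k`. So mean growth at rate `γ`
bounds the growth of all words at rate `γ δ ^ (-1 / p)`, and `p → ∞` removes `δ`. This handles
only finitely many matrices at a time, and with constants depending on the finite set. But bounded
operators all of whose finite subfamilies generate bounded semigroups admit, for every `b > 1`, a
common norm in which their operator norms are at most `b`: on the subspace of vectors with bounded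
orbit under the whole semigroup, the supremum along the orbit is such a norm, and one proceeds by
induction on the dimension of the quotient; the subspace is nonzero because otherwise finitely many
words would already double every vector. Finally, the dominated matrices are dense in the support:
atoms are dominated by themselves, and almost every point of the absolutely continuous part is
interior to the convex set of nonnegative matrices, hence dominated after shrinking. So the whole
support is contracting in a common norm. Conversely, by compactness of the support, absolute
asymptotic stability is uniformly exponential, which bounds all the means at one common rate.
-/

namespace SwitchedSystem

open scoped Matrix Pointwise

section Seminorm

variable {E : Type*} [NormedAddCommGroup E] [NormedSpace ℝ E] [FiniteDimensional ℝ E]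

theorem continuous_seminorm (p : Seminorm ℝ E) : Continuous p :=
  continuousOn_univ.1 (p.convexOn.continuousOn isOpen_univ)

theorem exists_seminorm_le_mul_norm (p : Seminorm ℝ E) :
    ∃ C : ℝ, 0 < C ∧ ∀ x, p x ≤ C * ‖x‖ :=
  p.bound_of_continuous_normedSpace (continuous_seminorm p)

theorem exists_norm_le_mul_seminorm_of_mem_cone {K : Set E} (hclosed : IsClosed K)
    (hsmul : ∀ c : ℝ, 0 ≤ c → ∀ x ∈ K, c • x ∈ K) (N : Seminorm ℝ E)
    (hN : ∀ x ∈ K, N x = 0 → x = 0) : ∃ C : ℝ, 0 < C ∧ ∀ x ∈ K, ‖x‖ ≤ C * N x := by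
  have : ProperSpace E := FiniteDimensional.proper_real E
  obtain ⟨C, hC⟩ := ((isCompact_sphere (0 : E) 1).inter_right hclosed).exists_bound_of_continuousOn
    (f := fun x => (N x)⁻¹) <| (continuous_seminorm N).continuousOn.inv₀ fun x hx h0 => by
      simpa [hN x hx.2 h0] using hx.1
  refine ⟨max C 1, by positivity, fun x hx => ?_⟩
  rcases eq_or_ne x 0 with rfl | hx0
  · simp
  have hNx : 0 < N x := (apply_nonneg N x).lt_of_ne' (mt (hN x hx) hx0)
  have hscale : N (‖x‖⁻¹ • x) = N x / ‖x‖ := by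
    rw [map_smul_eq_mul, norm_inv, norm_norm, inv_mul_eq_div]
  have hnormed := hC (‖x‖⁻¹ • x) ⟨by simp [norm_smul, hx0], hsmul _ (by positivity) x hx⟩
  rw [hscale, inv_div, Real.norm_of_nonneg (by positivity), div_le_iff₀ hNx] at hnormed
  exact hnormed.trans (by gcongr; exact le_max_left _ _)

theorem exists_norm_le_mul_seminorm (N : Seminorm ℝ E) (hN : ∀ x, N x = 0 → x = 0) :
    ∃ C : ℝ, 0 < C ∧ ∀ x, ‖x‖ ≤ C * N x := by
  simpa using exists_norm_le_mul_seminorm_of_mem_cone isClosed_univ (by simp) N fun x _ => hN x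

end Seminorm

section BoundedOrbits

variable {ι E : Type*} [NormedAddCommGroup E] [NormedSpace ℝ E]

/-- The subspace of vectors `x` whose orbit `{S x | S ∈ G}` is bounded. Pointwise boundedness of
the family `G` is expressed as `boundedOrbits G = ⊤`. -/
def boundedOrbits (G : Set (Module.End ℝ E)) : Submodule ℝ E where
  carrier := {x | ∃ C : ℝ, ∀ S ∈ G, ‖S x‖ ≤ C}
  zero_mem' := ⟨0, fun S _ => by simp⟩
  add_mem' := by
    rintro x y ⟨C, hC⟩ ⟨D, hD⟩
    refine ⟨C + D, fun S hS => ?_⟩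
    rw [map_add]
    exact norm_add_le_of_le (hC S hS) (hD S hS)
  smul_mem' := by
    rintro c x ⟨C, hC⟩
    refine ⟨‖c‖ * C, fun S hS => ?_⟩
    rw [map_smul, norm_smul]
    gcongr
    exact hC S hS

theorem boundedOrbits_anti {G H : Set (Module.End ℝ E)} (h : G ⊆ H) :
    boundedOrbits H ≤ boundedOrbits G :=
  fun _ ⟨C, hC⟩ => ⟨C, fun S hS => hC S (h hS)⟩

/-- The supremum of the norm along the orbit, as a seminorm on the vectors with bounded orbit. -/
noncomputable def orbitSeminorm (G : Set (Module.End ℝ E)) : Seminorm ℝ (boundedOrbits G) :=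
  ⨆ S : G, (normSeminorm ℝ E).comp ((S : Module.End ℝ E) ∘ₗ (boundedOrbits G).subtype)

theorem bddAbove_orbit {G : Set (Module.End ℝ E)} (x : boundedOrbits G) :
    BddAbove (Set.range fun S : G => ‖(S : Module.End ℝ E) x‖) := by
  obtain ⟨x, C, hC⟩ := x
  exact ⟨C, Set.forall_mem_range.2 fun S => hC S S.2⟩

theorem orbitSeminorm_apply {G : Set (Module.End ℝ E)} (x : boundedOrbits G) :
    orbitSeminorm G x = ⨆ S : G, ‖(S : Module.End ℝ E) x‖ :=
  Seminorm.iSup_apply (Seminorm.bddAbove_range_iff.2 bddAbove_orbit)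

theorem norm_apply_le_orbitSeminorm {G : Set (Module.End ℝ E)} {S : Module.End ℝ E} (hS : S ∈ G)
    (x : boundedOrbits G) : ‖S x‖ ≤ orbitSeminorm G x := by
  rw [orbitSeminorm_apply]
  exact le_ciSup (bddAbove_orbit x) (⟨S, hS⟩ : G)

theorem apply_mem_boundedOrbits {G : Submonoid (Module.End ℝ E)} {S : Module.End ℝ E}
    (hS : S ∈ G) : boundedOrbits (G : Set (Module.End ℝ E)) ≤ (boundedOrbits G).comap S :=
  fun _ ⟨C, hC⟩ => ⟨C, fun R hR => hC (R * S) (mul_mem hR hS)⟩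

theorem orbitSeminorm_restrict_le {G : Submonoid (Module.End ℝ E)} {S : Module.End ℝ E}
    (hS : S ∈ G) (x : boundedOrbits (G : Set (Module.End ℝ E))) :
    orbitSeminorm (G : Set (Module.End ℝ E)) (S.restrict (apply_mem_boundedOrbits hS) x) ≤
      orbitSeminorm (G : Set (Module.End ℝ E)) x := by
  rw [orbitSeminorm_apply]
  exact ciSup_le fun R => norm_apply_le_orbitSeminorm (mul_mem R.2 hS) x

variable [FiniteDimensional ℝ E]

theorem exists_norm_apply_le_of_boundedOrbits_eq_top {G : Set (Module.End ℝ E)}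
    (hG : boundedOrbits G = ⊤) : ∃ B : ℝ, 0 < B ∧ ∀ S ∈ G, ∀ x, ‖S x‖ ≤ B * ‖x‖ := by
  obtain ⟨B, hB, hBx⟩ := exists_seminorm_le_mul_norm (orbitSeminorm G)
  exact ⟨B, hB, fun S hS x =>
    (norm_apply_le_orbitSeminorm hS ⟨x, hG ▸ Submodule.mem_top⟩).trans (hBx _)⟩

/-- By compactness of the sphere, finitely many elements of `G` suffice to double every vector. -/
theorem exists_finset_two_mul_norm_lt {G : Set (Module.End ℝ E)} (hG : boundedOrbits G = ⊥) :
    ∃ W : Finset (Module.End ℝ E), ↑W ⊆ G ∧ ∀ x ≠ 0, ∃ S ∈ W, 2 * ‖x‖ < ‖S x‖ := by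
  have : ProperSpace E := FiniteDimensional.proper_real E
  have hcover : Metric.sphere (0 : E) 1 ⊆ ⋃ S ∈ G, {x | 2 < ‖S x‖} := fun x hx => by
    by_contra! hbdd
    simp only [Set.mem_iUnion, Set.mem_ofPred_eq, not_exists, not_lt] at hbdd
    have hx0 : x ∈ boundedOrbits G := ⟨2, hbdd⟩
    rw [hG, Submodule.mem_bot] at hx0
    simp [hx0] at hx
  obtain ⟨W, hWG, hWfin, hW⟩ := (isCompact_sphere (0 : E) 1).elim_finite_subcover_image
    (fun S _ => isOpen_lt continuous_const S.continuous_of_finiteDimensional.norm) hcover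
  refine ⟨hWfin.toFinset, by simpa using hWG, fun x hx => ?_⟩
  obtain ⟨S, hSW, hS⟩ := Set.mem_iUnion₂.1 (hW (by simp [norm_smul, hx] : ‖x‖⁻¹ • x ∈ _))
  refine ⟨S, hWfin.mem_toFinset.2 hSW, ?_⟩
  rwa [Set.mem_ofPred_eq, map_smul, norm_smul, norm_inv, norm_norm, ← div_eq_inv_mul,
    lt_div_iff₀ (norm_pos_iff.2 hx)] at hS

theorem exists_finset_boundedOrbits_closure_eq_bot {G : Set (Module.End ℝ E)}
    (hG : boundedOrbits G = ⊥) : ∃ W : Finset (Module.End ℝ E), ↑W ⊆ G ∧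
      boundedOrbits (Submonoid.closure (W : Set (Module.End ℝ E)) : Set (Module.End ℝ E)) = ⊥ := by
  obtain ⟨W, hWG, hW⟩ := exists_finset_two_mul_norm_lt hG
  refine ⟨W, hWG, (Submodule.eq_bot_iff _).2 fun x hx => by_contra fun hx0 => ?_⟩
  set H := Submonoid.closure (W : Set (Module.End ℝ E))
  set s := orbitSeminorm (H : Set (Module.End ℝ E)) ⟨x, hx⟩
  have hspos : 0 < s :=
    (norm_pos_iff.2 hx0).trans_le (norm_apply_le_orbitSeminorm H.one_mem ⟨x, hx⟩)
  have hlt : s / 2 < s := half_lt_self hspos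
  -- A vector of the orbit of nearly maximal norm can still be doubled.
  obtain ⟨⟨S, hSH⟩, hS⟩ : ∃ S : H, s / 2 < ‖(S : Module.End ℝ E) x‖ :=
    exists_lt_of_lt_ciSup (hlt.trans_eq (orbitSeminorm_apply _))
  obtain ⟨R, hRW, hR⟩ := hW (S x) (norm_pos_iff.1 ((half_pos hspos).trans hS))
  have hle : ‖(R * S) x‖ ≤ s :=
    norm_apply_le_orbitSeminorm (H.mul_mem (Submonoid.subset_closure hRW) hSH) ⟨x, hx⟩
  rw [Module.End.mul_apply] at hle
  linarith

end BoundedOrbits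

section Contraction

variable {ι : Type*}

theorem exists_finset_subset_closure {M : Type*} [Monoid M] (T : ι → M) (W : Finset M)
    (hW : ↑W ⊆ (Submonoid.closure (Set.range T) : Set M)) :
    ∃ F : Finset ι, ↑W ⊆ (Submonoid.closure (T '' F) : Set M) := by
  classical
  have hmono : Monotone fun F : Finset ι => Submonoid.closure (T '' (F : Set ι)) :=
    fun F F' h => Submonoid.closure_mono (Set.image_mono h)
  have hrange : Set.range T = ⋃ F : Finset ι, T '' (F : Set ι) := by
    rw [← Set.image_iUnion, ← Set.image_univ]
    congr 1
    exact (Set.eq_univ_of_forall fun i => Set.mem_iUnion.2 ⟨{i}, by simp⟩).symm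
  rw [hrange, Submonoid.closure_iUnion, Submonoid.coe_iSup_of_directed hmono.directed_le] at hW
  exact Directed.exists_mem_subset_of_finset_subset_biUnion
    (SetLike.coe_mono.comp hmono).directed_le hW

variable {E : Type*} [NormedAddCommGroup E] [NormedSpace ℝ E]

theorem boundedOrbits_quotient_eq_top {V : Submodule ℝ E} [IsClosed (V : Set E)]
    {G : Set (Module.End ℝ E)} {H : Set (Module.End ℝ (E ⧸ V))} (hG : boundedOrbits G = ⊤)
    (hGH : ∀ R ∈ H, ∃ S ∈ G, ∀ x, R (V.mkQ x) = V.mkQ (S x)) : boundedOrbits H = ⊤ := by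
  refine (Submodule.eq_top_iff').2 fun q => ?_
  obtain ⟨x, rfl⟩ := V.mkQ_surjective q
  obtain ⟨C, hC⟩ : x ∈ boundedOrbits G := hG ▸ Submodule.mem_top
  refine ⟨C, fun R hR => ?_⟩
  obtain ⟨S, hS, hRS⟩ := hGH R hR
  rw [hRS]
  exact (Submodule.Quotient.norm_mk_le V (S x)).trans (hC S hS)

theorem exists_mem_closure_of_mem_closure_mapQ {V : Submodule ℝ E} (T : ι → Module.End ℝ E)
    (hV : ∀ i, V ≤ V.comap (T i)) (s : Set ι) {R : Module.End ℝ (E ⧸ V)}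
    (hR : R ∈ Submonoid.closure ((fun i => V.mapQ V (T i) (hV i)) '' s)) :
    ∃ S ∈ Submonoid.closure (T '' s), ∀ x, R (V.mkQ x) = V.mkQ (S x) := by
  induction hR using Submonoid.closure_induction with
  | mem R hR =>
    obtain ⟨i, hi, rfl⟩ := hR
    exact ⟨T i, Submonoid.subset_closure ⟨i, hi, rfl⟩, fun x => rfl⟩
  | one => exact ⟨1, one_mem _, fun x => rfl⟩
  | mul R R' _ _ ih ih' =>
    obtain ⟨S, hS, hRS⟩ := ih
    obtain ⟨S', hS', hRS'⟩ := ih'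
    exact ⟨S * S', mul_mem hS hS', fun x => by simp only [Module.End.mul_apply, hRS', hRS]⟩

variable [FiniteDimensional ℝ E]

theorem exists_seminorm_apply_le_mul {F : Type*} [NormedAddCommGroup F] [NormedSpace ℝ F]
    [FiniteDimensional ℝ F] {G : Set (Module.End ℝ E)} (hG : boundedOrbits G = ⊤)
    (p : Seminorm ℝ E) (σ : F →ₗ[ℝ] E) {q : Seminorm ℝ F} (hq : ∀ y, q y = 0 → y = 0) :
    ∃ K : ℝ, 0 < K ∧ ∀ S ∈ G, ∀ y, p (S (σ y)) ≤ K * q y := by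
  obtain ⟨B, hB, hGB⟩ := exists_norm_apply_le_of_boundedOrbits_eq_top hG
  obtain ⟨C₁, hC₁, hp⟩ := exists_seminorm_le_mul_norm p
  obtain ⟨C₂, hC₂, hσ⟩ := exists_seminorm_le_mul_norm ((normSeminorm ℝ E).comp σ)
  obtain ⟨C₃, hC₃, hnorm⟩ := exists_norm_le_mul_seminorm q hq
  refine ⟨C₁ * (B * (C₂ * C₃)), by positivity, fun S hS y => ?_⟩
  calc p (S (σ y)) ≤ C₁ * ‖S (σ y)‖ := hp _
    _ ≤ C₁ * (B * ‖σ y‖) := by gcongr; exact hGB S hS _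
    _ ≤ C₁ * (B * (C₂ * ‖y‖)) := by gcongr; exact hσ y
    _ ≤ C₁ * (B * (C₂ * (C₃ * q y))) := by gcongr; exact hnorm y
    _ = C₁ * (B * (C₂ * C₃)) * q y := by ring

/-- Weighting the quotient norm heavily makes the off-diagonal blocks of the `T i` negligible. -/
theorem exists_seminorm_apply_le_of_quotient {T : ι → Module.End ℝ E} {V : Submodule ℝ E}
    (hV : ∀ i, V ≤ V.comap (T i)) (hT : boundedOrbits (Set.range T) = ⊤) {a b : ℝ}
    (hab : a < b) {N₁ : Seminorm ℝ V} (hN₁ : ∀ v, N₁ v = 0 → v = 0)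
    (hTN₁ : ∀ i v, N₁ ((T i).restrict (hV i) v) ≤ a * N₁ v)
    {N₂ : Seminorm ℝ (E ⧸ V)} (hN₂ : ∀ q, N₂ q = 0 → q = 0)
    (hTN₂ : ∀ i q, N₂ (V.mapQ V (T i) (hV i) q) ≤ a * N₂ q) :
    ∃ N : Seminorm ℝ E, (∀ x, N x = 0 → x = 0) ∧ ∀ i x, N (T i x) ≤ b * N x := by
  obtain ⟨σ, hσ⟩ := V.mkQ.exists_rightInverse_of_surjective V.range_mkQ
  have hmk (q : E ⧸ V) : V.mkQ (σ q) = q := LinearMap.congr_fun hσ q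
  let π : E →ₗ[ℝ] V := (LinearMap.id - σ ∘ₗ V.mkQ).codRestrict V fun x =>
    (Submodule.Quotient.mk_eq_zero V).1 (by simpa [sub_eq_zero] using (hmk (V.mkQ x)).symm)
  have hπ (x : E) : (π x : E) = x - σ (V.mkQ x) := rfl
  have hπV (v : V) : π v = v := Subtype.ext <| by
    simp [hπ, (Submodule.Quotient.mk_eq_zero V).2 v.2]
  have hclosed : IsClosed (V : Set E) := V.closed_of_finiteDimensional
  obtain ⟨K, hK, hcross⟩ := exists_seminorm_apply_le_mul hT (N₁.comp π) σ hN₂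
  have hba : 0 < b - a := sub_pos.2 hab
  obtain ⟨L, hL, hKL⟩ : ∃ L : NNReal, 0 < L ∧ K + L * a = L * b :=
    ⟨(K / (b - a)).toNNReal, by simpa using by positivity, by
      rw [Real.coe_toNNReal _ (by positivity)]; field_simp; ring⟩
  have hN (x : E) : (N₁.comp π + L • N₂.comp V.mkQ) x = N₁ (π x) + L * N₂ (V.mkQ x) := rfl
  refine ⟨N₁.comp π + L • N₂.comp V.mkQ, fun x hx => ?_, fun i x => ?_⟩
  · rw [hN, add_eq_zero_iff_of_nonneg (by positivity) (by positivity)] at hx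
    have hq : V.mkQ x = 0 := hN₂ _ ((mul_eq_zero_iff_left (by positivity)).1 hx.2)
    simpa [hπ, hq] using congrArg Subtype.val (hN₁ _ hx.1)
  · have hsplit : π (T i x) = (T i).restrict (hV i) (π x) + π (T i (σ (V.mkQ x))) := by
      rw [← hπV ((T i).restrict (hV i) (π x)), LinearMap.coe_restrict_apply, ← map_add, ← map_add,
        hπ, sub_add_cancel]
    rw [hN, hN]
    calc N₁ (π (T i x)) + L * N₂ (V.mkQ (T i x))
        ≤ (a * N₁ (π x) + K * N₂ (V.mkQ x)) + L * (a * N₂ (V.mkQ x)) := by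
          gcongr
          · rw [hsplit]
            exact (map_add_le_add N₁ _ _).trans (add_le_add (hTN₁ i _) (hcross _ ⟨i, rfl⟩ _))
          · exact hTN₂ i (V.mkQ x)
      _ = a * N₁ (π x) + b * (L * N₂ (V.mkQ x)) := by linear_combination N₂ (V.mkQ x) * hKL
      _ ≤ b * (N₁ (π x) + L * N₂ (V.mkQ x)) := by
          rw [mul_add]
          gcongr

theorem exists_seminorm_apply_le {b : ℝ} (hb : 1 < b) (T : ι → Module.End ℝ E)
    (hT : boundedOrbits (Set.range T) = ⊤)
    (hfin : ∀ F : Finset ι, boundedOrbits (Submonoid.closure (T '' F) : Set (Module.End ℝ E)) = ⊤) :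
    ∃ N : Seminorm ℝ E, (∀ x, N x = 0 → x = 0) ∧ ∀ i x, N (T i x) ≤ b * N x := by
  obtain ⟨n, hn⟩ : ∃ n, Module.finrank ℝ E = n := ⟨_, rfl⟩
  induction n using Nat.strong_induction_on generalizing E b with | _ n ih
  rcases subsingleton_or_nontrivial E with hE | hE
  · exact ⟨0, fun x _ => Subsingleton.elim _ _, fun i x => by simp⟩
  set G := Submonoid.closure (Set.range T)
  set V := boundedOrbits (G : Set (Module.End ℝ E))
  have hTG (i : ι) : T i ∈ G := Submonoid.subset_closure ⟨i, rfl⟩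
  have hV (i : ι) : V ≤ V.comap (T i) := apply_mem_boundedOrbits (hTG i)
  have hVne : V ≠ ⊥ := fun hbot => by
    obtain ⟨W, hWG, hW⟩ := exists_finset_boundedOrbits_closure_eq_bot hbot
    obtain ⟨F, hF⟩ := exists_finset_subset_closure T W hWG
    have htop := boundedOrbits_anti (Submonoid.closure_le.2 hF)
    rw [hfin F, hW] at htop
    exact top_ne_bot (le_bot_iff.1 htop)
  have hclosed : IsClosed (V : Set E) := V.closed_of_finiteDimensional
  have hlt : Module.finrank ℝ (E ⧸ V) < n := by
    have hpos := Submodule.one_le_finrank_iff.2 hVne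
    have hsum := V.finrank_quotient_add_finrank
    omega
  obtain ⟨a, ha, hab⟩ := exists_between hb
  obtain ⟨N₂, hN₂, hTN₂⟩ := ih _ hlt ha (fun i => V.mapQ V (T i) (hV i))
    (boundedOrbits_quotient_eq_top hT <|
      Set.forall_mem_range.2 fun i => ⟨T i, ⟨i, rfl⟩, fun _ => rfl⟩)
    (fun F => boundedOrbits_quotient_eq_top (hfin F) fun _ =>
      exists_mem_closure_of_mem_closure_mapQ T hV F) rfl
  refine exists_seminorm_apply_le_of_quotient hV hT hab
    (N₁ := orbitSeminorm (G : Set (Module.End ℝ E))) (fun v hv => ?_)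
    (fun i v => (orbitSeminorm_restrict_le (hTG i) v).trans
      (le_mul_of_one_le_left (apply_nonneg _ _) ha.le)) hN₂ hTN₂
  simpa [hv] using norm_apply_le_orbitSeminorm G.one_mem v

end Contraction

section Transition

/-- The transition product `A (k - 1) * ⋯ * A 0` of a sequence in a monoid, taking time `0` to
time `k`. -/
def transition {R : Type*} [Monoid R] (A : ℕ → R) : ℕ → R
  | 0 => 1
  | k + 1 => A k * transition A k

section Monoid

variable {R : Type*} [Monoid R]

@[simp]
theorem transition_zero (A : ℕ → R) : transition A 0 = 1 := rfl

theorem transition_succ (A : ℕ → R) (k : ℕ) : transition A (k + 1) = A k * transition A k := rfl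

theorem transition_add (A : ℕ → R) (m n : ℕ) :
    transition A (m + n) = transition (fun j => A (m + j)) n * transition A m := by
  induction n with
  | zero => rw [add_zero, transition_zero, one_mul]
  | succ n ih => rw [← add_assoc, transition_succ, ih, transition_succ, mul_assoc]

theorem transition_congr {A B : ℕ → R} {k : ℕ} (h : ∀ j < k, A j = B j) :
    transition A k = transition B k := by
  induction k with
  | zero => rfl
  | succ k ih =>
    rw [transition_succ, transition_succ, h k k.lt_succ_self, ih fun j hj => h j (by lia)]

theorem transition_mem {G : Submonoid R} {A : ℕ → R} {k : ℕ} (h : ∀ j < k, A j ∈ G) :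
    transition A k ∈ G := by
  induction k with
  | zero => exact one_mem G
  | succ k ih => exact mul_mem (h k k.lt_succ_self) (ih fun j hj => h j (by lia))

theorem exists_transition_eq_of_mem_closure {ι : Type*} [Nonempty ι] {f : ι → R} {s : Set ι}
    {x : R} (hx : x ∈ Submonoid.closure (f '' s)) :
    ∃ (i : ℕ → ι) (k : ℕ), (∀ j < k, i j ∈ s) ∧ transition (fun j => f (i j)) k = x := by
  induction hx using Submonoid.closure_induction_left with
  | one => exact ⟨fun _ => Classical.arbitrary ι, 0, by simp, rfl⟩
  | mul_left x hx y _ ih =>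
    obtain ⟨a, ha, rfl⟩ := hx
    obtain ⟨i, k, hi, rfl⟩ := ih
    refine ⟨Function.update i k a, k + 1, fun j hj => ?_, ?_⟩
    · rcases eq_or_ne j k with rfl | hjk
      · rwa [Function.update_self]
      · rw [Function.update_of_ne hjk]
        exact hi j (by lia)
    · rw [transition_succ, Function.update_self, transition_congr fun j hj => ?_]
      rw [Function.update_of_ne hj.ne]

end Monoid

theorem transition_sub_mem {R : Type*} [Ring R] {G : Subsemiring R} {A B : ℕ → R} {k : ℕ}
    (hB : ∀ j < k, B j ∈ G) (hAB : ∀ j < k, A j - B j ∈ G) :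
    transition A k - transition B k ∈ G := by
  induction k with
  | zero => simp [G.zero_mem]
  | succ k ih =>
    have hA (j : ℕ) (hj : j < k + 1) : A j ∈ G :=
      sub_add_cancel (A j) (B j) ▸ add_mem (hAB j hj) (hB j hj)
    have htelescope : transition A (k + 1) - transition B (k + 1) =
        A k * (transition A k - transition B k) + (A k - B k) * transition B k := by
      rw [transition_succ, transition_succ]
      noncomm_ring
    rw [htelescope]
    exact add_mem
      (mul_mem (hA k k.lt_succ_self) (ih (fun j hj => hB j (by lia)) fun j hj => hAB j (by lia)))
      (mul_mem (hAB k k.lt_succ_self)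
        (transition_mem (G := G.toSubmonoid) fun j hj => hB j (by lia)))

theorem continuous_transition {R : Type*} [Monoid R] [TopologicalSpace R] [ContinuousMul R]
    (k : ℕ) : Continuous fun A : ℕ → R => transition A k := by
  induction k with
  | zero => exact continuous_const
  | succ k ih => exact (continuous_apply k).mul ih

section SeminormedRing

variable {R : Type*} [SeminormedRing R] {S : Set R}

theorem exists_norm_transition_le_of_le (hS : IsCompact S) (m : ℕ) :
    ∃ B : ℝ, 0 < B ∧ ∀ A : ℕ → R, (∀ k, A k ∈ S) → ∀ k ≤ m, ‖transition A k‖ ≤ B := by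
  obtain ⟨B, hB⟩ := (isCompact_univ_pi fun _ : ℕ => hS).exists_bound_of_continuousOn
    (f := fun A => ∑ k ∈ Finset.range (m + 1), ‖transition A k‖)
    (continuous_finsetSum _ fun k _ => (continuous_transition k).norm).continuousOn
  refine ⟨max B 1, by positivity, fun A hA k hk => le_max_of_le_left ?_⟩
  calc ‖transition A k‖ ≤ ∑ k ∈ Finset.range (m + 1), ‖transition A k‖ :=
        Finset.single_le_sum (f := fun k => ‖transition A k‖) (fun _ _ => norm_nonneg _)
          (Finset.mem_range_succ_iff.2 hk)
    _ ≤ B := (le_abs_self _).trans (hB A fun k _ => hA k)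

theorem exists_norm_transition_succ_lt (hS : IsCompact S)
    (h : ∀ A : ℕ → R, (∀ k, A k ∈ S) → Tendsto (transition A) atTop (𝓝 0)) {ε : ℝ} (hε : 0 < ε) :
    ∃ m, ∀ A : ℕ → R, (∀ k, A k ∈ S) → ∃ k ≤ m, ‖transition A (k + 1)‖ < ε := by
  obtain ⟨m, hm⟩ := (isCompact_univ_pi fun _ : ℕ => hS).elim_directed_cover
    (fun m => ⋃ k ≤ m, {A : ℕ → R | ‖transition A (k + 1)‖ < ε})
    (fun m => isOpen_biUnion fun k _ => isOpen_lt (continuous_transition _).norm continuous_const)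
    (fun A hA => by
      have hsmall := (h A fun k => hA k trivial).norm.comp (tendsto_add_atTop_nat 1)
      rw [norm_zero] at hsmall
      obtain ⟨k, hk⟩ := (hsmall.eventually_lt_const hε).exists
      exact Set.mem_iUnion.2 ⟨k, Set.mem_iUnion₂.2 ⟨k, le_rfl, hk⟩⟩)
    (monotone_nat_of_le_succ fun m =>
      Set.biUnion_subset_biUnion_left fun k hk => Nat.le_succ_of_le hk).directed_le
  refine ⟨m, fun A hA => ?_⟩
  simpa using hm fun k _ => hA k

/-- Every trajectory is halved by some time `≤ m + 1`, and may then be restarted. -/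
theorem exists_norm_transition_le_mul_pow (hS : IsCompact S)
    (h : ∀ A : ℕ → R, (∀ k, A k ∈ S) → Tendsto (transition A) atTop (𝓝 0)) :
    ∃ C θ : ℝ, 0 < C ∧ 0 < θ ∧ θ < 1 ∧
      ∀ A : ℕ → R, (∀ k, A k ∈ S) → ∀ k, ‖transition A k‖ ≤ C * θ ^ k := by
  obtain ⟨m, hm⟩ := exists_norm_transition_succ_lt hS h one_half_pos
  obtain ⟨B, hB, hAB⟩ := exists_norm_transition_le_of_le hS m
  obtain ⟨θ, hθ, hθm⟩ : ∃ θ : ℝ, 0 ≤ θ ∧ θ ^ (m + 1) = 1 / 2 :=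
    ⟨(1 / 2 : ℝ) ^ (((m + 1 : ℕ) : ℝ)⁻¹), by positivity,
      Real.rpow_inv_natCast_pow (by norm_num) m.succ_ne_zero⟩
  have hθ0 : 0 < θ := hθ.lt_of_ne' fun h0 => by simp [h0] at hθm
  have hθ1 : θ < 1 := by
    by_contra! h1
    linarith [one_le_pow₀ h1 (n := m + 1)]
  have hhalf (n : ℕ) (hn : n ≤ m + 1) : 1 / 2 ≤ θ ^ n :=
    hθm ▸ pow_le_pow_of_le_one hθ hθ1.le hn
  refine ⟨2 * B, θ, by positivity, hθ0, hθ1, fun A hA k => ?_⟩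
  induction k using Nat.strong_induction_on generalizing A with | _ k ih
  rcases le_or_gt k m with hk | hk
  · linarith [hAB A hA k hk, mul_le_mul_of_nonneg_left (hhalf k (by lia)) hB.le]
  obtain ⟨n, hn, hsmall⟩ := hm A hA
  obtain ⟨r, rfl⟩ := Nat.exists_eq_add_of_le (show n + 1 ≤ k by lia)
  calc ‖transition A (n + 1 + r)‖
      ≤ ‖transition (fun j => A (n + 1 + j)) r‖ * ‖transition A (n + 1)‖ := by
        rw [transition_add]
        exact norm_mul_le _ _
    _ ≤ 2 * B * θ ^ r * θ ^ (n + 1) := by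
        gcongr
        · exact ih r (by lia) _ fun j => hA _
        · exact hsmall.le.trans (hhalf _ (by lia))
    _ = 2 * B * θ ^ (n + 1 + r) := by ring

end SeminormedRing

end Transition

section Deterministic

variable {d : ℕ}

theorem trajectory_eq_transition_mulVec (A : ℕ → Mat d) (x : Fin d → ℝ) (k : ℕ) :
    trajectory A x k = transition A k *ᵥ x := by
  induction k with
  | zero => rw [trajectory, transition_zero, Matrix.one_mulVec]
  | succ k ih => rw [trajectory, transition_succ, ih, Matrix.mulVec_mulVec]

theorem AbsolutelyAsymptoticallyStable.tendsto_transition {ℳ : Set (Mat d)}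
    (h : AbsolutelyAsymptoticallyStable ℳ) {A : ℕ → Mat d} (hA : ∀ k, A k ∈ ℳ) :
    Tendsto (transition A) atTop (𝓝 0) := by
  refine tendsto_pi_nhds.2 fun i => tendsto_pi_nhds.2 fun j => ?_
  have hcol := tendsto_pi_nhds.1 (h A hA (Pi.single j 1)) i
  simp only [trajectory_eq_transition_mulVec, Matrix.mulVec_single_one, Matrix.col_apply] at hcol
  exact hcol

theorem AbsolutelyAsymptoticallyStable.exists_seminorm_trajectory_le {ℳ : Set (Mat d)}
    (h : AbsolutelyAsymptoticallyStable ℳ) (hℳ : IsCompact ℳ) {N : Seminorm ℝ (Fin d → ℝ)}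
    (hN : ∀ x, N x = 0 → x = 0) :
    ∃ C θ : ℝ, 0 < C ∧ 0 < θ ∧ θ < 1 ∧ ∀ A : ℕ → Mat d, (∀ k, A k ∈ ℳ) →
      ∀ x k, N (trajectory A x k) ≤ C * θ ^ k * N x := by
  let _ := Matrix.linftyOpNormedRing (n := Fin d) (α := ℝ)
  obtain ⟨C, θ, hC, hθ, hθ1, hbound⟩ :=
    exists_norm_transition_le_mul_pow hℳ fun A hA => h.tendsto_transition hA
  obtain ⟨C₁, hC₁, hNnorm⟩ := exists_seminorm_le_mul_norm N
  obtain ⟨C₂, hC₂, hnormN⟩ := exists_norm_le_mul_seminorm N hN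
  refine ⟨C₁ * C * C₂, θ, by positivity, hθ, hθ1, fun A hA x k => ?_⟩
  calc N (trajectory A x k) ≤ C₁ * ‖transition A k *ᵥ x‖ :=
        trajectory_eq_transition_mulVec A x k ▸ hNnorm _
    _ ≤ C₁ * (‖transition A k‖ * ‖x‖) := by gcongr; exact Matrix.linfty_opNorm_mulVec _ _
    _ ≤ C₁ * (C * θ ^ k * (C₂ * N x)) := by gcongr; exacts [hbound A hA k, hnormN x]
    _ = C₁ * C * C₂ * θ ^ k * N x := by ring

theorem absolutelyAsymptoticallyStable_of_seminorm_le {ℳ : Set (Mat d)}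
    {N : Seminorm ℝ (Fin d → ℝ)} (hN : ∀ x, N x = 0 → x = 0) {q : ℝ} (hq0 : 0 ≤ q) (hq1 : q < 1)
    (hℳ : ∀ M ∈ ℳ, ∀ x, N (M *ᵥ x) ≤ q * N x) : AbsolutelyAsymptoticallyStable ℳ := by
  intro A hA x
  obtain ⟨C, hC, hnorm⟩ := exists_norm_le_mul_seminorm N hN
  have hpow (k : ℕ) : N (trajectory A x k) ≤ q ^ k * N x := by
    induction k with
    | zero => simp [trajectory]
    | succ k ih =>
      rw [pow_succ', mul_assoc]
      exact (hℳ _ (hA k) _).trans (mul_le_mul_of_nonneg_left ih hq0)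
  refine squeeze_zero_norm (fun k => (hnorm _).trans (mul_le_mul_of_nonneg_left (hpow k) hC.le)) ?_
  simpa using ((tendsto_pow_atTop_nhds_zero_of_lt_one hq0 hq1).mul_const (N x)).const_mul C

end Deterministic

section Cone

variable {d : ℕ} {K : Set (Fin d → ℝ)}

theorem IsProperCone.zero_mem (hK : IsProperCone K) : 0 ∈ K := by
  obtain ⟨e, he⟩ := hK.solid
  simpa using hK.smul_mem 0 le_rfl e (interior_subset he)

theorem IsProperCone.add_mem (hK : IsProperCone K) {x y : Fin d → ℝ} (hx : x ∈ K) (hy : y ∈ K) :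
    x + y ∈ K := by
  have hmid := hK.smul_mem 2 zero_le_two _ (hK.convex.midpoint_mem hx hy)
  rwa [midpoint_eq_smul_add, smul_smul, mul_invOf_self, one_smul] at hmid

/-- The matrices mapping the cone `K` into itself, that is, the nonnegative matrices for the
order in which `x ≤ y` means `y - x ∈ K`. -/
def IsProperCone.nonnegMatrices (hK : IsProperCone K) : Subsemiring (Mat d) where
  carrier := {M | ∀ x ∈ K, M *ᵥ x ∈ K}
  zero_mem' x _ := by rw [Matrix.zero_mulVec]; exact hK.zero_mem
  one_mem' x hx := by rwa [Matrix.one_mulVec]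
  add_mem' hM hM' x hx := by
    rw [Matrix.add_mulVec]
    exact hK.add_mem (hM x hx) (hM' x hx)
  mul_mem' hM hM' x hx := by
    rw [← Matrix.mulVec_mulVec]
    exact hM _ (hM' x hx)

theorem IsProperCone.smul_mem_nonnegMatrices (hK : IsProperCone K) {c : ℝ} (hc : 0 ≤ c)
    {M : Mat d} (hM : M ∈ hK.nonnegMatrices) : c • M ∈ hK.nonnegMatrices := fun x hx => by
  rw [Matrix.smul_mulVec]
  exact hK.smul_mem c hc _ (hM x hx)

theorem IsProperCone.isClosed_nonnegMatrices (hK : IsProperCone K) :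
    IsClosed (hK.nonnegMatrices : Set (Mat d)) := by
  have hinter : (hK.nonnegMatrices : Set (Mat d)) = ⋂ x ∈ K, (fun M : Mat d => M *ᵥ x) ⁻¹' K := by
    ext M
    simp [nonnegMatrices]
  rw [hinter]
  exact isClosed_biInter fun x _ =>
    hK.isClosed.preimage (continuous_id.matrix_mulVec continuous_const)

theorem IsProperCone.lebesgue_frontier_nonnegMatrices (hK : IsProperCone K) :
    lebesgue d (frontier (hK.nonnegMatrices : Set (Mat d))) = 0 := by
  have hconvex : Convex ℝ (hK.nonnegMatrices : Set (Mat d)) := fun M hM M' hM' a b ha hb _ =>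
    hK.nonnegMatrices.add_mem (hK.smul_mem_nonnegMatrices ha hM)
      (hK.smul_mem_nonnegMatrices hb hM')
  rw [show lebesgue d = (volume : Measure (Fin d → Fin d → ℝ)) from Measure.map_id]
  exact Convex.addHaar_frontier (E := Fin d → Fin d → ℝ) volume hconvex

theorem IsProperCone.exists_norm_le_mul_of_sub_mem (hK : IsProperCone K)
    {N : Seminorm ℝ (Fin d → ℝ)} (hN : ∀ x, N x = 0 → x = 0) :
    ∃ c : ℝ, 0 < c ∧ ∀ a ∈ K, ∀ b, b - a ∈ K → ‖a‖ ≤ c * N b := by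
  obtain ⟨c, hc, hbound⟩ := exists_norm_le_mul_seminorm_of_mem_cone
    (K := {z : (Fin d → ℝ) × (Fin d → ℝ) | z.1 ∈ K ∧ z.2 - z.1 ∈ K})
    ((hK.isClosed.preimage continuous_fst).inter
      (hK.isClosed.preimage (continuous_snd.sub continuous_fst)))
    (fun c hc z hz => ⟨hK.smul_mem c hc _ hz.1, smul_sub c z.2 z.1 ▸ hK.smul_mem c hc _ hz.2⟩)
    (N.comp (LinearMap.snd ℝ _ _)) (fun ⟨a, b⟩ ⟨ha, hab⟩ hb => by
      obtain rfl : b = 0 := hN b hb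
      rw [hK.pointed a ha (by simpa using hab), Prod.mk_zero_zero])
  exact ⟨c, hc, fun a ha b hab => (norm_fst_le (a, b)).trans (hbound (a, b) ⟨ha, hab⟩)⟩

theorem IsProperCone.exists_norm_mulVec_le_of_mem_interior (hK : IsProperCone K) {e : Fin d → ℝ}
    (he : e ∈ interior K) (x : Fin d → ℝ) :
    ∃ C : ℝ, 0 < C ∧ ∀ M ∈ hK.nonnegMatrices, ‖M *ᵥ x‖ ≤ C * ‖M *ᵥ e‖ := by
  obtain ⟨t, ht, hadd, hsub⟩ : ∃ t : ℝ, 0 < t ∧ e + t • x ∈ K ∧ e - t • x ∈ K := by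
    have hadd : Tendsto (fun t : ℝ => e + t • x) (𝓝[>] 0) (𝓝 e) :=
      tendsto_nhdsWithin_of_tendsto_nhds (Continuous.tendsto' (by fun_prop) _ _ (by simp))
    have hsub : Tendsto (fun t : ℝ => e - t • x) (𝓝[>] 0) (𝓝 e) :=
      tendsto_nhdsWithin_of_tendsto_nhds (Continuous.tendsto' (by fun_prop) _ _ (by simp))
    have heK := mem_interior_iff_mem_nhds.1 he
    have hpos : ∀ᶠ t : ℝ in 𝓝[>] 0, 0 < t := self_mem_nhdsWithin
    exact (hpos.and ((hadd.eventually_mem heK).and (hsub.eventually_mem heK))).exists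
  obtain ⟨c, hc, hnormal⟩ :=
    hK.exists_norm_le_mul_of_sub_mem (N := normSeminorm ℝ _) fun _ hx => norm_eq_zero.1 hx
  refine ⟨t⁻¹ * (c * 2 + 1), by positivity, fun M hM => ?_⟩
  have hle : ‖M *ᵥ (e + t • x)‖ ≤ c * ‖(2 : ℝ) • M *ᵥ e‖ := by
    refine hnormal _ (hM _ hadd) _ ?_
    rw [← Matrix.mulVec_smul, ← Matrix.mulVec_sub, two_smul, add_sub_add_left_eq_sub]
    exact hM _ hsub
  rw [norm_smul, Real.norm_ofNat] at hle
  calc ‖M *ᵥ x‖ = t⁻¹ * ‖M *ᵥ (e + t • x) - M *ᵥ e‖ := by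
        rw [← Matrix.mulVec_sub, add_sub_cancel_left, Matrix.mulVec_smul, norm_smul,
          Real.norm_of_nonneg ht.le, inv_mul_cancel_left₀ ht.ne']
    _ ≤ t⁻¹ * (c * (2 * ‖M *ᵥ e‖) + ‖M *ᵥ e‖) := by
        gcongr
        exact (norm_sub_le _ _).trans (add_le_add_left hle _)
    _ = t⁻¹ * (c * 2 + 1) * ‖M *ᵥ e‖ := by ring

end Cone

section Dominated

variable {d : ℕ} {K : Set (Fin d → ℝ)} {μ : Measure (Mat d)}

/-- The `K`-nonnegative matrices that a random matrix with law `μ` dominates, in the order of `K`,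
with positive probability. -/
def dominatedMatrices (μ : Measure (Mat d)) (hK : IsProperCone K) : Set (Mat d) :=
  {M | M ∈ hK.nonnegMatrices ∧ 0 < μ {A | A - M ∈ hK.nonnegMatrices}}

theorem zero_mem_dominatedMatrices [NeZero μ] (hK : IsProperCone K)
    (hinv : LeavesInvariant μ.support K) : 0 ∈ dominatedMatrices μ hK := by
  have hae : ∀ᵐ A ∂μ, A - 0 ∈ hK.nonnegMatrices := by
    filter_upwards [Measure.support_mem_ae (μ := μ)] with A hA
    rw [sub_zero]
    exact hinv A hA
  exact ⟨zero_mem _, pos_iff_ne_zero.2 (frequently_ae_iff.1 hae.frequently)⟩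

theorem mem_dominatedMatrices_of_measure_singleton_ne_zero (hK : IsProperCone K)
    (hinv : LeavesInvariant μ.support K) {M : Mat d} (hM : μ {M} ≠ 0) :
    M ∈ dominatedMatrices μ hK := by
  have hpos : 0 < μ {M} := pos_iff_ne_zero.2 hM
  obtain ⟨_, rfl, hsupp⟩ := Measure.nonempty_inter_support_of_pos hpos
  exact ⟨hinv _ hsupp, hpos.trans_le (measure_mono (by simp [zero_mem]))⟩

theorem smul_mem_dominatedMatrices (hK : IsProperCone K) {M : Mat d} (hsupp : M ∈ μ.support)
    (hM : M ∈ interior (hK.nonnegMatrices : Set (Mat d))) {q : ℝ} (hq0 : 0 ≤ q) (hq1 : q < 1) :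
    q • M ∈ dominatedMatrices μ hK := by
  have hq : 0 < 1 - q := sub_pos.2 hq1
  have hint : M - q • M ∈ interior (hK.nonnegMatrices : Set (Mat d)) := by
    have hscale : (1 - q) • (hK.nonnegMatrices : Set (Mat d)) ⊆ hK.nonnegMatrices :=
      Set.smul_set_subset_iff.2 fun _ hA => hK.smul_mem_nonnegMatrices hq.le hA
    refine interior_mono hscale ?_
    rw [interior_smul₀ hq.ne', show M - q • M = (1 - q) • M by rw [sub_smul, one_smul]]
    exact Set.smul_mem_smul_set hM
  have hcont : Continuous fun A : Mat d => A - q • M := by fun_prop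
  exact ⟨hK.smul_mem_nonnegMatrices hq0 (interior_subset hM),
    (Measure.mem_support_iff_forall _).1 hsupp _
      (hcont.continuousAt (mem_interior_iff_mem_nhds.1 hint))⟩

theorem mem_closure_dominatedMatrices_of_mem_interior (hK : IsProperCone K) {M : Mat d}
    (hsupp : M ∈ μ.support) (hM : M ∈ interior (hK.nonnegMatrices : Set (Mat d))) :
    M ∈ closure (dominatedMatrices μ hK) := by
  have hlim : Tendsto (fun q : ℝ => q • M) (𝓝[<] 1) (𝓝 M) :=
    tendsto_nhdsWithin_of_tendsto_nhds (Continuous.tendsto' (by fun_prop) _ _ (one_smul ℝ M))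
  refine mem_closure_of_tendsto hlim ?_
  filter_upwards [Ioo_mem_nhdsLT zero_lt_one] with q hq
  exact smul_mem_dominatedMatrices hK hsupp hM hq.1.le hq.2

theorem support_subset_closure_dominatedMatrices [SigmaFinite μ] (hK : IsProperCone K)
    (hinv : LeavesInvariant μ.support K)
    (hatoms : (μ.singularPart (lebesgue d)).support ⊆ closure {M | μ {M} ≠ 0}) :
    μ.support ⊆ closure (dominatedMatrices μ hK) := by
  set ν := (lebesgue d).withDensity (μ.rnDeriv (lebesgue d))
  have hdecomp : μ.singularPart (lebesgue d) + ν = μ :=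
    (μ.haveLebesgueDecomposition_add (lebesgue d)).symm
  have hsingular : (μ.singularPart (lebesgue d)).support ⊆ closure (dominatedMatrices μ hK) :=
    hatoms.trans <| closure_mono fun M hM =>
      mem_dominatedMatrices_of_measure_singleton_ne_zero hK hinv hM
  have habscont : ν.support ⊆ closure (dominatedMatrices μ hK) := by
    refine Measure.support_subset_of_isClosed isClosed_closure ?_
    have hsupp : μ.support ∈ ae ν := ae_mono (Measure.withDensity_rnDeriv_le μ _)
      Measure.support_mem_ae
    have hfrontier : ν (frontier (hK.nonnegMatrices : Set (Mat d))) = 0 :=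
      withDensity_absolutelyContinuous _ _ hK.lebesgue_frontier_nonnegMatrices
    filter_upwards [hsupp, measure_eq_zero_iff_ae_notMem.1 hfrontier] with M hM hMf
    refine mem_closure_dominatedMatrices_of_mem_interior hK hM ?_
    exact by_contra fun hMi => hMf ⟨subset_closure (hinv M hM), hMi⟩
  calc μ.support = (μ.singularPart (lebesgue d)).support ∪ ν.support := by
        rw [← Measure.support_add, hdecomp]
    _ ⊆ closure (dominatedMatrices μ hK) := Set.union_subset hsingular habscont

theorem exists_norm_mulVec_le_of_mem_dominatedMatrices (hcompact : IsCompact μ.support)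
    (hK : IsProperCone K) (x : Fin d → ℝ) :
    ∃ C : ℝ, ∀ M ∈ dominatedMatrices μ hK, ‖M *ᵥ x‖ ≤ C := by
  obtain ⟨e, he⟩ := hK.solid
  obtain ⟨C, hC, hinterior⟩ := hK.exists_norm_mulVec_le_of_mem_interior he x
  obtain ⟨c, hc, hnormal⟩ :=
    hK.exists_norm_le_mul_of_sub_mem (N := normSeminorm ℝ _) fun _ hx => norm_eq_zero.1 hx
  obtain ⟨B, hB⟩ := hcompact.exists_bound_of_continuousOn (f := fun A : Mat d => A *ᵥ e)
    (continuous_id.matrix_mulVec continuous_const).continuousOn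
  refine ⟨C * (c * B), fun M ⟨hMK, hM⟩ => ?_⟩
  obtain ⟨A, hAM, hA⟩ := Measure.nonempty_inter_support_of_pos hM
  have heK := interior_subset he
  calc ‖M *ᵥ x‖ ≤ C * ‖M *ᵥ e‖ := hinterior M hMK
    _ ≤ C * (c * ‖A *ᵥ e‖) := by
        gcongr
        exact hnormal _ (hMK e heK) _ (by rw [← Matrix.sub_mulVec]; exact hAM e heK)
    _ ≤ C * (c * B) := by gcongr; exact hB A hA

theorem ConeAndAtomicSingularPart.support_singularPart_subset (h : ConeAndAtomicSingularPart μ) :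
    (μ.singularPart (lebesgue d)).support ⊆ closure {M | μ {M} ≠ 0} := by
  obtain ⟨n, p, M, hp, hsing⟩ := h.singular_atomic
  have hle : ∑ i, ENNReal.ofReal (p i) • Measure.dirac (M i) ≤ μ :=
    hsing ▸ Measure.singularPart_le μ (lebesgue d)
  have hatom (i : Fin n) : μ {M i} ≠ 0 := by
    refine ((ENNReal.ofReal_pos.2 (hp i)).trans_le ?_).ne'
    calc ENNReal.ofReal (p i) = (ENNReal.ofReal (p i) • Measure.dirac (M i)) {M i} := by simp
      _ ≤ (∑ i, ENNReal.ofReal (p i) • Measure.dirac (M i)) {M i} := by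
        rw [Measure.finsetSum_apply]
        exact Finset.single_le_sum
          (f := fun j => (ENNReal.ofReal (p j) • Measure.dirac (M j)) {M i})
          (fun _ _ => zero_le) (Finset.mem_univ i)
      _ ≤ μ {M i} := hle _
  refine Measure.support_subset_of_isClosed isClosed_closure ?_
  rw [hsing, mem_ae_iff, Measure.finsetSum_apply]
  refine Finset.sum_eq_zero fun i _ => ?_
  have hmem : M i ∈ closure {M | μ {M} ≠ 0} := subset_closure (hatom i)
  simp [isClosed_closure.measurableSet.compl, hmem]

end Dominated

section Probability

variable {d : ℕ} {K : Set (Fin d → ℝ)} {μ : Measure (Mat d)} {Ω : Type*} [MeasurableSpace Ω]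
  {P : Measure Ω} {A : ℕ → Ω → Mat d} {nrm : Seminorm ℝ (Fin d → ℝ)}

theorem FollowIndependently.ae_mem_support (hA : FollowIndependently A μ P) :
    ∀ᵐ ω ∂P, ∀ k, A k ω ∈ μ.support := by
  refine ae_all_iff.2 fun k => ae_of_ae_map (hA.hasLaw k).aemeasurable ?_
  rw [(hA.hasLaw k).map_eq]
  exact Measure.support_mem_ae

theorem meanPow_nonneg (p : ℕ) (x : Fin d → ℝ) (k : ℕ) : 0 ≤ meanPow P nrm A p x k :=
  integral_nonneg fun _ => pow_nonneg (apply_nonneg nrm _) p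

theorem FollowIndependently.integrable_pow [IsFiniteMeasure P] (hA : FollowIndependently A μ P)
    (hcompact : IsCompact μ.support) (nrm : Seminorm ℝ (Fin d → ℝ)) (p : ℕ) (x : Fin d → ℝ)
    (k : ℕ) : Integrable (fun ω => nrm (trajectory (fun j => A j ω) x k) ^ p) P := by
  have hcont : Continuous fun B : ℕ → Mat d => nrm (trajectory B x k) ^ p := by
    simp only [trajectory_eq_transition_mulVec]
    exact ((continuous_seminorm nrm).comp
      ((continuous_transition k).matrix_mulVec continuous_const)).pow p
  have hmeas : AEMeasurable (fun ω j => A j ω) P :=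
    aemeasurable_pi_iff.2 fun j => (hA.hasLaw j).aemeasurable
  obtain ⟨C, hC⟩ :=
    (isCompact_univ_pi fun _ : ℕ => hcompact).exists_bound_of_continuousOn hcont.continuousOn
  refine Integrable.of_bound (hcont.measurable.comp_aemeasurable hmeas).aestronglyMeasurable C ?_
  filter_upwards [hA.ae_mem_support] with ω hω using hC _ fun k _ => hω k

theorem FollowIndependently.meanPow_le [IsProbabilityMeasure P] (hA : FollowIndependently A μ P)
    (hcompact : IsCompact μ.support) {x : Fin d → ℝ} {k : ℕ} {b : ℝ}
    (hb : ∀ B : ℕ → Mat d, (∀ j, B j ∈ μ.support) → nrm (trajectory B x k) ≤ b) (p : ℕ) :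
    meanPow P nrm A p x k ≤ b ^ p := by
  have hae : ∀ᵐ ω ∂P, nrm (trajectory (fun j => A j ω) x k) ^ p ≤ b ^ p := by
    filter_upwards [hA.ae_mem_support] with ω hω
    exact pow_le_pow_left₀ (apply_nonneg nrm _) (hb _ hω) p
  calc meanPow P nrm A p x k ≤ ∫ _, b ^ p ∂P :=
        integral_mono_ae (hA.integrable_pow hcompact nrm p x k) (integrable_const _) hae
    _ = b ^ p := by simp

theorem FollowIndependently.pow_le_measureReal (hA : FollowIndependently A μ P)
    {S : ℕ → Set (Mat d)} (hS : ∀ j, MeasurableSet (S j)) {δ : ℝ} (hδ : 0 ≤ δ) {k : ℕ}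
    (h : ∀ j < k, δ ≤ μ.real (S j)) : δ ^ k ≤ P.real {ω | ∀ j < k, A j ω ∈ S j} := by
  have hinter : {ω | ∀ j < k, A j ω ∈ S j} = ⋂ j ∈ Finset.range k, A j ⁻¹' S j := by
    ext ω
    simp
  have hprod : P.real {ω | ∀ j < k, A j ω ∈ S j} = ∏ j ∈ Finset.range k, μ.real (S j) := by
    rw [hinter, measureReal_def, (iIndepFun_iff_measure_inter_preimage_eq_mul.1 hA.indep)
      (Finset.range k) fun j _ => hS j, ENNReal.toReal_prod]
    refine Finset.prod_congr rfl fun j _ => ?_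
    rw [measureReal_def, ← (hA.hasLaw j).map_eq,
      Measure.map_apply_of_aemeasurable (hA.hasLaw j).aemeasurable (hS j)]
  calc δ ^ k = ∏ _j ∈ Finset.range k, δ := by rw [Finset.prod_const, Finset.card_range]
    _ ≤ ∏ j ∈ Finset.range k, μ.real (S j) :=
      Finset.prod_le_prod (fun _ _ => hδ) fun j hj => h j (Finset.mem_range.1 hj)
    _ = _ := hprod.symm

/-- Markov's inequality on the event that `A j` dominates `M j` for all `j < k`. -/
theorem FollowIndependently.pow_mul_norm_pow_le_meanPow [IsFiniteMeasure P]
    (hA : FollowIndependently A μ P) (hcompact : IsCompact μ.support) (hK : IsProperCone K)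
    {c : ℝ} (hc : 0 ≤ c) (hcK : ∀ a ∈ K, ∀ b, b - a ∈ K → ‖a‖ ≤ c * nrm b)
    {e : Fin d → ℝ} (he : e ∈ K) {δ : ℝ} (hδ : 0 ≤ δ) {M : ℕ → Mat d} {k : ℕ}
    (hM : ∀ j < k, M j ∈ hK.nonnegMatrices)
    (hMδ : ∀ j < k, δ ≤ μ.real {B | B - M j ∈ hK.nonnegMatrices}) (p : ℕ) :
    δ ^ k * ‖transition M k *ᵥ e‖ ^ p ≤ c ^ p * meanPow P nrm A p e k := by
  have hmeas (j : ℕ) : MeasurableSet {B | B - M j ∈ hK.nonnegMatrices} :=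
    (hK.isClosed_nonnegMatrices.preimage (by fun_prop : Continuous (· - M j))).measurableSet
  set r := ‖transition M k *ᵥ e‖ ^ p
  have hdominate (B : ℕ → Mat d) (hB : ∀ j < k, B j - M j ∈ hK.nonnegMatrices) :
      r ≤ c ^ p * nrm (trajectory B e k) ^ p := by
    rw [trajectory_eq_transition_mulVec, ← mul_pow]
    refine pow_le_pow_left₀ (norm_nonneg _) (hcK _ ?_ _ ?_) p
    · exact transition_mem (G := hK.nonnegMatrices.toSubmonoid) hM e he
    · rw [← Matrix.sub_mulVec]
      exact transition_sub_mem hM hB e he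
  calc δ ^ k * r ≤ r * P.real {ω | r ≤ c ^ p * nrm (trajectory (fun j => A j ω) e k) ^ p} := by
        rw [mul_comm]
        gcongr
        exact (hA.pow_le_measureReal hmeas hδ hMδ).trans
          (measureReal_mono fun ω hω => hdominate _ hω)
    _ ≤ ∫ ω, c ^ p * nrm (trajectory (fun j => A j ω) e k) ^ p ∂P :=
        mul_meas_ge_le_integral_of_nonneg (Eventually.of_forall fun _ => by positivity)
          ((hA.integrable_pow hcompact nrm p e k).const_mul _) r
    _ = c ^ p * meanPow P nrm A p e k := integral_const_mul _ _

theorem exists_pos_le_measureReal_of_subset_dominatedMatrices [IsFiniteMeasure μ]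
    (hK : IsProperCone K) {F : Finset (Mat d)} (hF : ↑F ⊆ dominatedMatrices μ hK) :
    ∃ δ : ℝ, 0 < δ ∧ ∀ M ∈ F, δ ≤ μ.real {B | B - M ∈ hK.nonnegMatrices} := by
  have hsmall : ∀ᶠ δ : ℝ in 𝓝[>] 0, ∀ M ∈ F, δ ≤ μ.real {B | B - M ∈ hK.nonnegMatrices} :=
    (eventually_all_finset F).2 fun M hM => (eventually_le_nhds
      (ENNReal.toReal_pos (hF hM).2.ne' (measure_ne_top μ _))).filter_mono nhdsWithin_le_nhds
  have hpos : ∀ᶠ δ : ℝ in 𝓝[>] 0, 0 < δ := self_mem_nhdsWithin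
  exact (hpos.and hsmall).exists

/-- A product of `k` elements of `F` is dominated with probability at least `δ ^ k`, and the loss
`δ ^ (-k / p)` in the `p`th mean is absorbed by `(η / g) ^ k` once `p` is large. -/
theorem FollowIndependently.exists_norm_transition_mulVec_le [IsFiniteMeasure P]
    [IsFiniteMeasure μ] (hA : FollowIndependently A μ P) (hcompact : IsCompact μ.support)
    (hnrm : ∀ x, nrm x = 0 → x = 0) (hK : IsProperCone K) {e : Fin d → ℝ} (he : e ∈ K)
    {g η : ℝ} (hg : 0 < g) (hgη : g < η)
    (hmean : ∃ᶠ p : ℕ in atTop, ∃ C : ℝ, 0 < C ∧ ∀ k, meanPow P nrm A p e k ≤ (C * g ^ k) ^ p)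
    {F : Finset (Mat d)} (hF : ↑F ⊆ dominatedMatrices μ hK) :
    ∃ C : ℝ, 0 < C ∧ ∀ (M : ℕ → Mat d) (k : ℕ), (∀ j < k, M j ∈ F) →
      ‖transition M k *ᵥ e‖ ≤ C * η ^ k := by
  have hη : 0 < η := hg.trans hgη
  obtain ⟨δ, hδ, hFδ⟩ := exists_pos_le_measureReal_of_subset_dominatedMatrices hK hF
  obtain ⟨c, hc, hcK⟩ := hK.exists_norm_le_mul_of_sub_mem hnrm
  have hlarge : ∀ᶠ p : ℕ in atTop, (g / η) ^ p < δ :=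
    (tendsto_pow_atTop_nhds_zero_of_lt_one (by positivity)
      ((div_lt_one hη).2 hgη)).eventually_lt_const hδ
  obtain ⟨p, ⟨C, hC, hmean⟩, hp, hp0⟩ :=
    (hmean.and_eventually (hlarge.and (eventually_ne_atTop 0))).exists
  rw [div_pow, div_lt_iff₀ (by positivity)] at hp
  refine ⟨c * C, by positivity, fun M k hM => le_of_pow_le_pow_left₀ hp0 (by positivity) ?_⟩
  refine le_of_mul_le_mul_left ?_ (pow_pos hδ k)
  calc δ ^ k * ‖transition M k *ᵥ e‖ ^ p ≤ c ^ p * meanPow P nrm A p e k :=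
        hA.pow_mul_norm_pow_le_meanPow hcompact hK hc.le hcK he hδ.le
          (fun j hj => (hF (hM j hj)).1) (fun j hj => hFδ _ (hM j hj)) p
    _ ≤ c ^ p * (C * g ^ k) ^ p := by gcongr; exact hmean k
    _ = (c * C) ^ p * (g ^ p) ^ k := by ring
    _ ≤ (c * C) ^ p * (δ * η ^ p) ^ k := by gcongr
    _ = δ ^ k * (c * C * η ^ k) ^ p := by ring

theorem transition_smul_mulVecLin (c : ℝ) (M : ℕ → Mat d) (k : ℕ) :
    transition (fun j => c • (M j).mulVecLin) k = c ^ k • (transition M k).mulVecLin := by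
  induction k with
  | zero => simp [Module.End.one_eq_id]
  | succ k ih =>
    rw [transition_succ, ih, transition_succ, Matrix.mulVecLin_mul, pow_succ', smul_mul_smul_comm,
      Module.End.mul_eq_comp]

theorem FollowIndependently.boundedOrbits_closure_smul_eq_top [IsFiniteMeasure P]
    [IsFiniteMeasure μ] [Nonempty (dominatedMatrices μ hK)]
    (hA : FollowIndependently A μ P) (hcompact : IsCompact μ.support)
    (hnrm : ∀ x, nrm x = 0 → x = 0) {g η : ℝ} (hg : 0 < g) (hgη : g < η)
    (hmean : ∀ x, ∃ᶠ p : ℕ in atTop, ∃ C : ℝ, 0 < C ∧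
      ∀ k, meanPow P nrm A p x k ≤ (C * g ^ k) ^ p)
    (F : Finset (dominatedMatrices μ hK)) :
    boundedOrbits (Submonoid.closure
      ((fun M : dominatedMatrices μ hK => η⁻¹ • (M : Mat d).mulVecLin) '' F) :
        Set (Module.End ℝ (Fin d → ℝ))) = ⊤ := by
  have hη : 0 < η := hg.trans hgη
  obtain ⟨e, he⟩ := hK.solid
  obtain ⟨C, -, hCe⟩ := hA.exists_norm_transition_mulVec_le hcompact hnrm hK (interior_subset he)
    hg hgη (hmean e) (F := F.map (.subtype _)) (by simp)
  refine Submodule.eq_top_iff'.2 fun x => ?_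
  obtain ⟨C', hC', hCx⟩ := hK.exists_norm_mulVec_le_of_mem_interior he x
  refine ⟨C' * C, fun S hS => ?_⟩
  obtain ⟨M, k, hMF, rfl⟩ := exists_transition_eq_of_mem_closure hS
  rw [transition_smul_mulVecLin, LinearMap.smul_apply, norm_smul,
    Real.norm_of_nonneg (by positivity), inv_pow, inv_mul_le_iff₀ (by positivity),
    Matrix.mulVecLin_apply]
  calc ‖transition (fun j => (M j : Mat d)) k *ᵥ x‖
      ≤ C' * ‖transition (fun j => (M j : Mat d)) k *ᵥ e‖ :=
        hCx _ (transition_mem (G := hK.nonnegMatrices.toSubmonoid) fun j _ => (M j).2.1)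
    _ ≤ C' * (C * η ^ k) := by
        gcongr
        exact hCe _ k fun j hj => Finset.mem_map_of_mem _ (hMF j hj)
    _ = η ^ k * (C' * C) := by ring

theorem exists_meanPow_le_of_isBigO {p : ℕ} (hp : p ≠ 0) {x : Fin d → ℝ} {g : ℝ} (hg : 0 < g)
    (h : (fun k : ℕ => meanPow P nrm A p x k ^ (1 / (p : ℝ))) =O[atTop] (fun k : ℕ => g ^ k)) :
    ∃ C : ℝ, 0 < C ∧ ∀ k, meanPow P nrm A p x k ≤ (C * g ^ k) ^ p := by
  obtain ⟨C, hC, hbound⟩ := bound_of_isBigO_nat_atTop h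
  refine ⟨C, hC, fun k => ?_⟩
  have hmean : 0 ≤ meanPow P nrm A p x k := meanPow_nonneg p x k
  have hk := hbound (pow_ne_zero k hg.ne')
  rw [Real.norm_of_nonneg (by positivity), Real.norm_of_nonneg (by positivity)] at hk
  calc meanPow P nrm A p x k = (meanPow P nrm A p x k ^ (1 / (p : ℝ))) ^ p := by
        rw [one_div, Real.rpow_inv_natCast_pow hmean hp]
    _ ≤ (C * g ^ k) ^ p := pow_le_pow_left₀ (by positivity) hk p

theorem FollowIndependently.exists_seminorm_mulVec_le [IsFiniteMeasure P]
    [IsFiniteMeasure μ] [NeZero μ] (hA : FollowIndependently A μ P)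
    (hcompact : IsCompact μ.support) (hnrm : ∀ x, nrm x = 0 → x = 0) (hK : IsProperCone K)
    (hinv : LeavesInvariant μ.support K)
    (hatoms : (μ.singularPart (lebesgue d)).support ⊆ closure {M | μ {M} ≠ 0})
    {g q : ℝ} (hg : 0 < g) (hgq : g < q)
    (hmean : ∀ x, ∃ᶠ p : ℕ in atTop, ∃ C : ℝ, 0 < C ∧
      ∀ k, meanPow P nrm A p x k ≤ (C * g ^ k) ^ p) :
    ∃ N : Seminorm ℝ (Fin d → ℝ), (∀ x, N x = 0 → x = 0) ∧
      ∀ M ∈ μ.support, ∀ x, N (M *ᵥ x) ≤ q * N x := by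
  obtain ⟨η, hgη, hηq⟩ := exists_between hgq
  have hη : 0 < η := hg.trans hgη
  have : Nonempty (dominatedMatrices μ hK) := ⟨0, zero_mem_dominatedMatrices hK hinv⟩
  obtain ⟨N, hN, hcontract⟩ := exists_seminorm_apply_le ((one_lt_div hη).2 hηq)
    (fun M : dominatedMatrices μ hK => η⁻¹ • (M : Mat d).mulVecLin)
    (Submodule.eq_top_iff'.2 fun x => by
      obtain ⟨C, hC⟩ := exists_norm_mulVec_le_of_mem_dominatedMatrices hcompact hK x
      refine ⟨η⁻¹ * C, Set.forall_mem_range.2 fun M => ?_⟩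
      rw [LinearMap.smul_apply, norm_smul, Real.norm_of_nonneg (by positivity)]
      gcongr
      exact hC M M.2)
    (hA.boundedOrbits_closure_smul_eq_top hcompact hnrm hg hgη hmean)
  refine ⟨N, hN, fun M hM x => ?_⟩
  have hclosed : IsClosed {M : Mat d | N (M *ᵥ x) ≤ q * N x} :=
    isClosed_le ((continuous_seminorm N).comp (continuous_id.matrix_mulVec continuous_const))
      continuous_const
  refine closure_minimal (fun M hM => ?_) hclosed
    (support_subset_closure_dominatedMatrices hK hinv hatoms hM)
  have hNM := hcontract ⟨M, hM⟩ x
  rwa [LinearMap.smul_apply, map_smul_eq_mul, Real.norm_of_nonneg (by positivity),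
    inv_mul_le_iff₀ hη, ← mul_assoc, mul_div_cancel₀ _ hη.ne'] at hNM

theorem FollowIndependently.absolutelyAsymptoticallyStable [IsFiniteMeasure P]
    [IsFiniteMeasure μ] [NeZero μ] (hA : FollowIndependently A μ P)
    (hcompact : IsCompact μ.support) (hnrm : ∀ x, nrm x = 0 → x = 0) (hK : IsProperCone K)
    (hinv : LeavesInvariant μ.support K)
    (hatoms : (μ.singularPart (lebesgue d)).support ⊆ closure {M | μ {M} ≠ 0})
    {γ : ℝ} (hγ0 : 0 ≤ γ) (hγ1 : γ < 1)
    (hmean : ∀ x, ∃ᶠ p : ℕ in atTop,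
      (fun k : ℕ => meanPow P nrm A p x k ^ (1 / (p : ℝ))) =O[atTop] (fun k : ℕ => γ ^ k)) :
    AbsolutelyAsymptoticallyStable μ.support := by
  obtain ⟨g, hγg, hg1⟩ := exists_between hγ1
  obtain ⟨q, hgq, hq1⟩ := exists_between hg1
  have hg : 0 < g := hγ0.trans_lt hγg
  have hγgO : (fun k : ℕ => γ ^ k) =O[atTop] (fun k : ℕ => g ^ k) :=
    (isLittleO_pow_pow_of_lt_left hγ0 hγg).isBigO
  obtain ⟨N, hN, hcontract⟩ := hA.exists_seminorm_mulVec_le hcompact hnrm hK hinv hatoms hg hgq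
    fun x => ((hmean x).and_eventually (eventually_ne_atTop 0)).mono
      fun p hp => exists_meanPow_le_of_isBigO hp.2 hg (hp.1.trans hγgO)
  exact absolutelyAsymptoticallyStable_of_seminorm_le hN (hg.trans hgq).le hq1 hcontract

theorem meanStableWithRate_of_meanPow_le {p : ℕ} (hp : p ≠ 0) {C θ : ℝ} (hC : 0 < C)
    (hθ0 : 0 < θ) (hθ1 : θ < 1)
    (h : ∀ x k, meanPow P nrm A p x k ≤ (C * θ ^ k * nrm x) ^ p) :
    MeanStableWithRate P nrm A p θ := by
  have hexp : Real.exp (-(p * -Real.log θ)) = θ ^ p := by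
    rw [mul_neg, neg_neg, Real.exp_nat_mul, Real.exp_log hθ0]
  refine ⟨C ^ p, p * -Real.log θ, by positivity, ?_, ?_, fun x k => (h x k).trans_eq ?_⟩
  · exact mul_pos (by positivity) (neg_pos.2 (Real.log_neg hθ0 hθ1))
  · rw [hexp, one_div, Real.pow_rpow_inv_natCast hθ0.le hp]
  · rw [mul_comm _ (k : ℝ), Real.exp_nat_mul, hexp]
    ring

theorem FollowIndependently.exists_meanStableWithRate [IsProbabilityMeasure P]
    (hA : FollowIndependently A μ P) (hcompact : IsCompact μ.support)
    (hnrm : ∀ x, nrm x = 0 → x = 0) (h : AbsolutelyAsymptoticallyStable μ.support) :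
    ∃ γ : ℝ, 0 ≤ γ ∧ γ < 1 ∧ ∀ p : ℕ, 1 ≤ p → MeanStableWithRate P nrm A p γ := by
  obtain ⟨C, θ, hC, hθ0, hθ1, hbound⟩ := h.exists_seminorm_trajectory_le hcompact hnrm
  exact ⟨θ, hθ0.le, hθ1, fun p hp => meanStableWithRate_of_meanPow_le (by lia) hC hθ0 hθ1
    fun x k => hA.meanPow_le hcompact (fun B hB => hbound B hB x k) p⟩

theorem MeanStableWithRate.isBigO {p : ℕ} (hp : p ≠ 0) {γ : ℝ} (hγ : 0 ≤ γ)
    (h : MeanStableWithRate P nrm A p γ) (x : Fin d → ℝ) :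
    (fun k : ℕ => meanPow P nrm A p x k ^ (1 / (p : ℝ))) =O[atTop] (fun k : ℕ => γ ^ k) := by
  obtain ⟨M, β, hM, _, hγβ, hbound⟩ := h
  refine IsBigO.of_bound (M ^ (1 / (p : ℝ)) * nrm x) (Eventually.of_forall fun k => ?_)
  have hmean : 0 ≤ meanPow P nrm A p x k := meanPow_nonneg p x k
  have hx := apply_nonneg nrm x
  rw [Real.norm_of_nonneg (by positivity), Real.norm_of_nonneg (by positivity)]
  calc meanPow P nrm A p x k ^ (1 / (p : ℝ))
      ≤ (M * Real.exp (-β * k) * nrm x ^ p) ^ (1 / (p : ℝ)) := by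
        gcongr
        exact hbound x k
    _ = M ^ (1 / (p : ℝ)) * (Real.exp (-β) ^ (1 / (p : ℝ))) ^ k * nrm x := by
        rw [Real.mul_rpow (by positivity) (by positivity), Real.mul_rpow hM.le (by positivity),
          one_div, Real.pow_rpow_inv_natCast hx hp, ← Real.exp_mul, ← Real.exp_mul,
          ← Real.exp_nat_mul]
        ring_nf
    _ ≤ M ^ (1 / (p : ℝ)) * γ ^ k * nrm x := by gcongr
    _ = M ^ (1 / (p : ℝ)) * nrm x * γ ^ k := by ring

end Probability

end SwitchedSystem

open SwitchedSystem in
theorem mainTheorem4_general {d : ℕ} (μ : Measure (Mat d)) [IsProbabilityMeasure μ]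
    (hcompact : IsCompact μ.support) {K : Set (Fin d → ℝ)} (hK : IsProperCone K)
    (hinv : LeavesInvariant μ.support K)
    (hatoms : (μ.singularPart (lebesgue d)).support ⊆ closure {M | μ {M} ≠ 0})
    (nrm : Seminorm ℝ (Fin d → ℝ)) (hnrm : ∀ x, nrm x = 0 → x = 0)
    {Ω : Type*} [MeasurableSpace Ω] (P : Measure Ω) [IsProbabilityMeasure P]
    (A : ℕ → Ω → Mat d) (hA : FollowIndependently A μ P) :
    (AbsolutelyAsymptoticallyStable μ.support ↔
      ∃ γ : ℝ, 0 ≤ γ ∧ γ < 1 ∧ ∀ p : ℕ, 1 ≤ p → MeanStableWithRate P nrm A p γ) ∧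
    (AbsolutelyAsymptoticallyStable μ.support ↔
      ∃ γ : ℝ, 0 ≤ γ ∧ γ < 1 ∧ ∀ p : ℕ, 1 ≤ p → ∀ x₀ : Fin d → ℝ,
        (fun k : ℕ => meanPow P nrm A p x₀ k ^ (1 / (p : ℝ)))
          =O[atTop] (fun k : ℕ => γ ^ k)) := by
  have stable_rate := hA.exists_meanStableWithRate hcompact hnrm
  have rate_bigO (γ : ℝ) (hγ : 0 ≤ γ) (h : ∀ p : ℕ, 1 ≤ p → MeanStableWithRate P nrm A p γ)
      (p : ℕ) (hp : 1 ≤ p) := (h p hp).isBigO (by lia) hγ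
  have bigO_stable (γ : ℝ) (hγ0 : 0 ≤ γ) (hγ1 : γ < 1) (h : ∀ p : ℕ, 1 ≤ p → ∀ x₀ : Fin d → ℝ,
      (fun k : ℕ => meanPow P nrm A p x₀ k ^ (1 / (p : ℝ))) =O[atTop] (fun k : ℕ => γ ^ k)) :=
    hA.absolutelyAsymptoticallyStable hcompact hnrm hK hinv hatoms hγ0 hγ1 fun x =>
      ((eventually_ge_atTop 1).mono fun p hp => h p hp x).frequently
  refine ⟨⟨stable_rate, ?_⟩, fun h => ?_, ?_⟩
  · rintro ⟨γ, hγ0, hγ1, h⟩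
    exact bigO_stable γ hγ0 hγ1 (rate_bigO γ hγ0 h)
  · obtain ⟨γ, hγ0, hγ1, hγ⟩ := stable_rate h
    exact ⟨γ, hγ0, hγ1, rate_bigO γ hγ0 hγ⟩
  · rintro ⟨γ, hγ0, hγ1, h⟩
    exact bigO_stable γ hγ0 hγ1 h

theorem mainTheorem4 {d : ℕ} (μ : Measure (SwitchedSystem.Mat d)) [IsProbabilityMeasure μ]
    (hcompact : IsCompact μ.support)
    (hμ : SwitchedSystem.ConeAndAtomicSingularPart μ)
    (nrm : Seminorm ℝ (Fin d → ℝ)) (hnrm : ∀ x, nrm x = 0 → x = 0)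
    {Ω : Type*} [MeasurableSpace Ω] (P : Measure Ω) [IsProbabilityMeasure P]
    (A : ℕ → Ω → SwitchedSystem.Mat d)
    (hA : SwitchedSystem.FollowIndependently A μ P) :
    (SwitchedSystem.AbsolutelyAsymptoticallyStable μ.support ↔
      ∃ γ : ℝ, 0 ≤ γ ∧ γ < 1 ∧ ∀ p : ℕ, 1 ≤ p →
        SwitchedSystem.MeanStableWithRate P nrm A p γ) ∧
    (SwitchedSystem.AbsolutelyAsymptoticallyStable μ.support ↔
      ∃ γ : ℝ, 0 ≤ γ ∧ γ < 1 ∧ ∀ p : ℕ, 1 ≤ p → ∀ x₀ : Fin d → ℝ,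
        (fun k : ℕ => SwitchedSystem.meanPow P nrm A p x₀ k ^ (1 / (p : ℝ)))
          =O[atTop] (fun k : ℕ => γ ^ k)) := by
  obtain ⟨K, hK, hinv⟩ := hμ.invariant_cone
  exact mainTheorem4_general μ hcompact hK hinv hμ.support_singularPart_subset nrm hnrm P A hA
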